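/- Bicategories, pseudofunctors, pseudonatural transformations and modifications are meant in the usual weak sense. For bicategories $\mathbf{X},\mathbf{Y}$, $\mathbf{Y}^{\mathbf{X}}$ is the bicategory of pseudofunctors $\mathbf{X}\to\mathbf{Y}$, pseudonatural transformations and modifications. For a pseudonatural transformation $\alpha\colon P\Rightarrow Q$, write $\alpha_R\colon PR\Rightarrow QR$ and $S\alpha=S(\alpha)\colon SP\Rightarrow SQ$ for its whiskerings with pseudofunctors $R$ and $S$, and similarly for modifications; when $\alpha$ has source or target an identity pseudofunctor, its whiskerings are composed with the canonical unitors $R\simeq \mathrm{Id}\,R$, $S\simeq S\,\mathrm{Id}$. We write $\simeq$ for the associators of composition of pseudofunctors. *Definitions.* A *biadjunction* $L\dashv R$ between pseudofunctors $L\colon\mathbf{Y}\to\mathbf{X}$, $R\colon\mathbf{X}\to\mathbf{Y}$ consists of pseudonatural transformations $\eta\colon \mathrm{Id}_{\mathbf Y}\Rightarrow RL$ and $\varepsilon\colon LR\Rightarrow\mathrm{Id}_{\mathbf X}$ and invertible modifications $\varepsilon_L\circ L\eta\cong \mathrm{Id}_L$ and $R\varepsilon\circ\eta_R\cong\mathrm{Id}_R$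 (associators understood). In a bicategory, a 1-morphism $f\colon X\to Y$ is *fully faithful* if for every object $Z$ the functor $\mathrm{Hom}(Z,X)\to\mathrm{Hom}(Z,Y)$, $h\mapsto f\circ h$, is fully faithful. An *inverter* of a 2-morphism $\varphi\colon f_1\Rightarrow f_2\colon X_1\to X_2$ is a pair $(X_0,f_0\colon X_0\to X_1)$ such that $\varphi * f_0$ is invertible and such that, for every object $X$, $h\mapsto f_0\circ h$ is an equivalence from $\mathrm{Hom}(X,X_0)$ to the full subcategory of $\mathrm{Hom}(X,X_1)$ formed by the $f$ for which $\varphi * f$ is invertible. *Data.* Let $F\colon \mathbf{A}\to\mathbf{B}$, $G\colon\mathbf{B}\to\mathbf{C}$ and $H\colon\mathbf{A}\to\mathbf{C}$ be pseudofunctors between bicategories, with a pseudonatural equivalence $\Gamma\colon GF\Rightarrow H$, and let $L\dashv F$ be a biadjunction with unit $\Phi$, and $N\dashv H$ a biadjunction with unit $\Psi$ and counit $\Upsilon$. Then $N\dashv GF$ with unit $\Psi'=\Gamma^{-1}_N\circ\Psi\colon \mathrm{Id}_{\mathbf C}\Rightarrow (GF)N$ and counit $\Upsilon'=\Upsilon\circ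 N\Gamma\colon N(GF)\Rightarrow \mathrm{Id}_{\mathbf A}$. Put - $\Phi'\colon G\xRightarrow{G\Phi}G(FL)\simeq(GF)L$; - $\Theta\colon NG\xRightarrow{N\Phi'}N((GF)L)\simeq(N(GF))L\xRightarrow{\Upsilon'_L}L$; - $\Theta'\colon (FN)G\simeq F(NG)\xRightarrow{F\Theta}FL$; - $\Psi''\colon\mathrm{Id}_{\mathbf C}\xRightarrow{\Psi'}(GF)N\simeq G(FN)$; - $\Xi'\colon FN\xRightarrow{(FN)\Psi''}(FN)(G(FN))\simeq((FN)G)(FN)$; - $\Xi\colon FN\xRightarrow{\Xi'}((FN)G)(FN)\xRightarrow{\Theta'_{FN}}(FL)(FN)$; - $\Theta''\colon((FL)(FN))G\simeq(FL)((FN)G)\xRightarrow{(FL)\Theta'}(FL)(FL)$. Let $\phi_1\colon \Theta''\circ(\Phi_{FN})_G\cong\Phi_{FL}\circ\Theta'$ be the invertible modification obtained from the associativity $(\Phi_{FN})_G\cong\Phi_{(FN)G}$ of whiskering followed by the pseudonaturality 2-cell $\Phi_{\Theta'}$. Let $\phi_2\colon\Theta''\circ\Xi_G\cong(FL)\Phi\circ\Theta'$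 be the following invertible modification. By associativity of whiskering and the interchange 2-cell $\Theta'_{\Theta'}$, $$\Theta''\circ\Xi_G\;\cong\;\Theta'_{FL}\circ((FN)G)\Theta'\circ A\circ\Xi'_G,$$ and, by a pentagonator and associativity of whiskering, $$((FN)G)\Theta'\circ A\circ\Xi'_G\;\cong\; A\circ (FN)\bigl(G\Theta'\circ A\circ\Psi''_G\bigr),$$ where each $A$ is the appropriate associator. The invertible modification $\phi_2''\colon G\Theta'\circ A\circ\Psi''_G\cong G\Phi$ is obtained by expanding $\Psi''$, $\Theta'$ and $\Theta$, applying pentagonators and the pseudonaturality of associators, using the interchange 2-cell $\Psi'_{\Phi'}$ and the right triangle law of $N\dashv GF$ whiskered by $L$ (this law being the one transported along $\Gamma$ from the right triangle law of $N\dashv H$), and cancelling the associator in $\Phi'$. Finally $\phi_2$ is completed by $A\circ(FN)(G\Phi)\cong((FN)G)\Phi$ and the inverse of the interchange 2-cell $\Theta'_\Phi\colon (FL)\Phi\circ\Theta'\cong\Theta'_{FL}\circ((FN)G)\Phi$. **Theorem.** Assume that 1. there is a modification $\mu\colon\Phi_{FN}\Rrightarrow\Xi$ with an inverter $(M,\ \Lambda\colon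 M\Rightarrow FN)$ in $\mathbf{B}^{\mathbf{C}}$; 2. $(GM,G(\Lambda))$ is an inverter of $G(\mu)$ in $\mathbf{C}^{\mathbf{C}}$; 3. $G(\mu)*\Psi''$ is invertible; 4. $(\mathrm{Id}_{\mathbf B},\Phi)$ is an inverter in $\mathbf{B}^{\mathbf{B}}$ of a modification $\nu\colon\Phi_{FL}\Rrightarrow FL(\Phi)$ such that $$\phi_2\circ(\Theta''*\mu_G)=(\nu*\Theta')\circ\phi_1;$$ 5. $G(\Phi)$ is fully faithful in $\mathbf{C}^{\mathbf{B}}$; 6. $\Phi_{FN}$ is fully faithful in $\mathbf{B}^{\mathbf{C}}$. Then $M$ is left biadjoint to $G$, i.e. there is a biadjunction $M\dashv G$. -/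

import Mathlib

open CategoryTheory Bicategory
open scoped CategoryTheory.Pseudofunctor.StrongTrans

namespace BiadjTriangle

universe w₁ w₂ w₃ w₄ v₁ v₂ v₃ v₄ u₁ u₂ u₃ u₄ w₅ v₅ u₅

section Whiskering

variable {A : Type u₁} [Bicategory.{w₁, v₁} A] {B : Type u₂} [Bicategory.{w₂, v₂} B]
  {C : Type u₃} [Bicategory.{w₃, v₃} C] {D : Type u₄} [Bicategory.{w₄, v₄} D]
  {E : Type u₅} [Bicategory.{w₅, v₅} E]

/-- Pre-whiskering of a pseudonatural transformation `Ψ : G₁ ⟶ G₂` by a pseudofunctor `F`: `Ψ_F`, with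
components `Ψ_{F X}`. Composition of pseudofunctors is written in diagrammatic order, so `F.comp G` is
`G F`. -/
def preWhisker (F : A ⥤ᵖ B) {G₁ G₂ : B ⥤ᵖ C} (Ψ : G₁ ⟶ G₂) : F.comp G₁ ⟶ F.comp G₂ where
  app X := Ψ.app (F.obj X)
  naturality f := Ψ.naturality (F.map f)
  naturality_naturality η := Ψ.naturality_naturality (F.map₂ η)
  naturality_id X := by
    delta Pseudofunctor.comp PrelaxFunctor.comp PrelaxFunctorStruct.comp Prefunctor.comp
    simp [-Pseudofunctor.StrongTrans.naturality_naturality,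
      ← Pseudofunctor.StrongTrans.naturality_naturality_assoc]
  naturality_comp f g := by
    delta Pseudofunctor.comp PrelaxFunctor.comp PrelaxFunctorStruct.comp Prefunctor.comp
    simp [-Pseudofunctor.StrongTrans.naturality_naturality,
      ← Pseudofunctor.StrongTrans.naturality_naturality_assoc]

lemma map_whiskerLeft_map₂ (G : B ⥤ᵖ C) {X Y Z : B} (f : X ⟶ Y) {g h : Y ⟶ Z} (η : g ⟶ h) :
    G.map f ◁ G.map₂ η = (G.mapComp f g).inv ≫ G.map₂ (f ◁ η) ≫ (G.mapComp f h).hom := by simp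

lemma map₂_whiskerRight_map (G : B ⥤ᵖ C) {X Y Z : B} {f g : X ⟶ Y} (η : f ⟶ g) (h : Y ⟶ Z) :
    G.map₂ η ▷ G.map h = (G.mapComp f h).inv ≫ G.map₂ (η ▷ h) ≫ (G.mapComp g h).hom := by simp

lemma map₂_associator_inv' (G : B ⥤ᵖ C) {W X Y Z : B} (f : W ⟶ X) (g : X ⟶ Y) (h : Y ⟶ Z) :
    G.map₂ (α_ f g h).inv = (G.mapComp f (g ≫ h)).hom ≫ G.map f ◁ (G.mapComp g h).hom ≫
      (α_ (G.map f) (G.map g) (G.map h)).inv ≫ (G.mapComp f g).inv ▷ G.map h ≫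
      (G.mapComp (f ≫ g) h).inv := by
  rw [← cancel_epi (G.map₂ (α_ f g h).hom), PrelaxFunctor.map₂_hom_inv]
  simp

lemma map₂_rightUnitor_inv' (G : B ⥤ᵖ C) {X Y : B} (f : X ⟶ Y) :
    G.map₂ (ρ_ f).inv = (ρ_ (G.map f)).inv ≫ G.map f ◁ (G.mapId Y).inv ≫
      (G.mapComp f (𝟙 Y)).inv := by
  rw [← cancel_epi (G.map₂ (ρ_ f).hom), PrelaxFunctor.map₂_hom_inv]
  simp

lemma map₂_leftUnitor_inv' (G : B ⥤ᵖ C) {X Y : B} (f : X ⟶ Y) :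
    G.map₂ (λ_ f).inv = (λ_ (G.map f)).inv ≫ (G.mapId X).inv ▷ G.map f ≫
      (G.mapComp (𝟙 X) f).inv := by
  rw [← cancel_epi (G.map₂ (λ_ f).hom), PrelaxFunctor.map₂_hom_inv]
  simp

lemma whiskerLeft_map₂_inv_hom (G : B ⥤ᵖ C) {X Y : B} {Z : C} {f g : X ⟶ Y} (e : f ≅ g)
    (h : Z ⟶ G.obj X) : h ◁ G.map₂ e.inv ≫ h ◁ G.map₂ e.hom = 𝟙 _ :=
  whiskerLeft_inv_hom h (G.map₂Iso e)

lemma whiskerLeft_map₂_inv_hom_assoc (G : B ⥤ᵖ C) {X Y : B} {Z : C} {f g : X ⟶ Y} (e : f ≅ g)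
    (h : Z ⟶ G.obj X) {k : Z ⟶ G.obj Y} (θ : h ≫ G.map g ⟶ k) :
    h ◁ G.map₂ e.inv ≫ h ◁ G.map₂ e.hom ≫ θ = θ := by
  rw [← Category.assoc, whiskerLeft_map₂_inv_hom, Category.id_comp]

/-- Post-whiskering of a pseudonatural transformation `Φ : F₁ ⟶ F₂` by a pseudofunctor `G`: `G(Φ)`, with
components `G(Φ_X)`. -/
def postWhisker {F₁ F₂ : A ⥤ᵖ B} (Φ : F₁ ⟶ F₂) (G : B ⥤ᵖ C) : F₁.comp G ⟶ F₂.comp G where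
  app X := G.map (Φ.app X)
  naturality f := (G.mapComp _ _).symm ≪≫ G.map₂Iso (Φ.naturality f) ≪≫ G.mapComp _ _
  naturality_naturality η := by
    delta Pseudofunctor.comp PrelaxFunctor.comp PrelaxFunctorStruct.comp Prefunctor.comp
    simp [map_whiskerLeft_map₂, map₂_whiskerRight_map, ← PrelaxFunctor.map₂_comp_assoc,
      -PrelaxFunctor.map₂_comp, -Pseudofunctor.map₂_whisker_right, -Pseudofunctor.map₂_whisker_left]
  naturality_id X := by
    delta Pseudofunctor.comp PrelaxFunctor.comp PrelaxFunctorStruct.comp Prefunctor.comp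
    simp [Pseudofunctor.StrongTrans.naturality_id_hom, map₂_rightUnitor_inv',
      whiskerLeft_map₂_inv_hom_assoc]
  naturality_comp f g := by
    delta Pseudofunctor.comp PrelaxFunctor.comp PrelaxFunctorStruct.comp Prefunctor.comp
    simp [Pseudofunctor.StrongTrans.naturality_comp_hom, map₂_associator_inv',
      whiskerLeft_map₂_inv_hom_assoc]

/-- The associator `H (G F) ⟶ (H G) F` of composition of pseudofunctors (identity components). -/
def assocHom (F : A ⥤ᵖ B) (G : B ⥤ᵖ C) (H : C ⥤ᵖ D) :
    (F.comp G).comp H ⟶ F.comp (G.comp H) where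
  app X := 𝟙 (H.obj (G.obj (F.obj X)))
  naturality f := ρ_ (H.map (G.map (F.map f))) ≪≫ (λ_ (H.map (G.map (F.map f)))).symm
  naturality_naturality η := by
    delta Pseudofunctor.comp PrelaxFunctor.comp PrelaxFunctorStruct.comp Prefunctor.comp
    simp
  naturality_id X := by
    delta Pseudofunctor.comp PrelaxFunctor.comp PrelaxFunctorStruct.comp Prefunctor.comp
    simp [Bicategory.unitors_inv_equal, PrelaxFunctor.mapFunctor]
  naturality_comp f g := by
    delta Pseudofunctor.comp PrelaxFunctor.comp PrelaxFunctorStruct.comp Prefunctor.comp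
    simp [PrelaxFunctor.mapFunctor]

/-- The inverse associator `(H G) F ⟶ H (G F)` (identity components). -/
def assocInv (F : A ⥤ᵖ B) (G : B ⥤ᵖ C) (H : C ⥤ᵖ D) :
    F.comp (G.comp H) ⟶ (F.comp G).comp H where
  app X := 𝟙 (H.obj (G.obj (F.obj X)))
  naturality f := ρ_ (H.map (G.map (F.map f))) ≪≫ (λ_ (H.map (G.map (F.map f)))).symm
  naturality_naturality η := by
    delta Pseudofunctor.comp PrelaxFunctor.comp PrelaxFunctorStruct.comp Prefunctor.comp
    simp
  naturality_id X := by
    delta Pseudofunctor.comp PrelaxFunctor.comp PrelaxFunctorStruct.comp Prefunctor.comp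
    simp [Bicategory.unitors_inv_equal, PrelaxFunctor.mapFunctor]
  naturality_comp f g := by
    delta Pseudofunctor.comp PrelaxFunctor.comp PrelaxFunctorStruct.comp Prefunctor.comp
    simp [PrelaxFunctor.mapFunctor]

/-- The unitor `F ⟶ F ∘ Id`. -/
def toIdComp (F : A ⥤ᵖ B) : F ⟶ (Pseudofunctor.id A).comp F where
  app X := 𝟙 (F.obj X)
  naturality f := ρ_ (F.map f) ≪≫ (λ_ (F.map f)).symm
  naturality_naturality η := by
    delta Pseudofunctor.comp PrelaxFunctor.comp PrelaxFunctorStruct.comp Prefunctor.comp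
    delta Pseudofunctor.id PrelaxFunctor.id PrelaxFunctorStruct.id Prefunctor.id
    simp
  naturality_id X := by
    delta Pseudofunctor.comp PrelaxFunctor.comp PrelaxFunctorStruct.comp Prefunctor.comp
    delta Pseudofunctor.id PrelaxFunctor.id PrelaxFunctorStruct.id Prefunctor.id
    simp [Bicategory.unitors_inv_equal, PrelaxFunctor.mapFunctor]
  naturality_comp f g := by
    delta Pseudofunctor.comp PrelaxFunctor.comp PrelaxFunctorStruct.comp Prefunctor.comp
    delta Pseudofunctor.id PrelaxFunctor.id PrelaxFunctorStruct.id Prefunctor.id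
    simp [PrelaxFunctor.mapFunctor]

/-- The unitor `F ∘ Id ⟶ F`. -/
def ofIdComp (F : A ⥤ᵖ B) : (Pseudofunctor.id A).comp F ⟶ F where
  app X := 𝟙 (F.obj X)
  naturality f := ρ_ (F.map f) ≪≫ (λ_ (F.map f)).symm
  naturality_naturality η := by
    delta Pseudofunctor.comp PrelaxFunctor.comp PrelaxFunctorStruct.comp Prefunctor.comp
    delta Pseudofunctor.id PrelaxFunctor.id PrelaxFunctorStruct.id Prefunctor.id
    simp
  naturality_id X := by
    delta Pseudofunctor.comp PrelaxFunctor.comp PrelaxFunctorStruct.comp Prefunctor.comp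
    delta Pseudofunctor.id PrelaxFunctor.id PrelaxFunctorStruct.id Prefunctor.id
    simp [Bicategory.unitors_inv_equal, PrelaxFunctor.mapFunctor]
  naturality_comp f g := by
    delta Pseudofunctor.comp PrelaxFunctor.comp PrelaxFunctorStruct.comp Prefunctor.comp
    delta Pseudofunctor.id PrelaxFunctor.id PrelaxFunctorStruct.id Prefunctor.id
    simp [PrelaxFunctor.mapFunctor]

/-- The unitor `F ⟶ Id ∘ F`. -/
def toCompId (F : A ⥤ᵖ B) : F ⟶ F.comp (Pseudofunctor.id B) where
  app X := 𝟙 (F.obj X)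
  naturality f := ρ_ (F.map f) ≪≫ (λ_ (F.map f)).symm
  naturality_naturality η := by
    delta Pseudofunctor.comp PrelaxFunctor.comp PrelaxFunctorStruct.comp Prefunctor.comp
    delta Pseudofunctor.id PrelaxFunctor.id PrelaxFunctorStruct.id Prefunctor.id
    simp
  naturality_id X := by
    delta Pseudofunctor.comp PrelaxFunctor.comp PrelaxFunctorStruct.comp Prefunctor.comp
    delta Pseudofunctor.id PrelaxFunctor.id PrelaxFunctorStruct.id Prefunctor.id
    simp [Bicategory.unitors_inv_equal, PrelaxFunctor.mapFunctor]
  naturality_comp f g := by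
    delta Pseudofunctor.comp PrelaxFunctor.comp PrelaxFunctorStruct.comp Prefunctor.comp
    delta Pseudofunctor.id PrelaxFunctor.id PrelaxFunctorStruct.id Prefunctor.id
    simp [PrelaxFunctor.mapFunctor]

/-- The unitor `Id ∘ F ⟶ F`. -/
def ofCompId (F : A ⥤ᵖ B) : F.comp (Pseudofunctor.id B) ⟶ F where
  app X := 𝟙 (F.obj X)
  naturality f := ρ_ (F.map f) ≪≫ (λ_ (F.map f)).symm
  naturality_naturality η := by
    delta Pseudofunctor.comp PrelaxFunctor.comp PrelaxFunctorStruct.comp Prefunctor.comp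
    delta Pseudofunctor.id PrelaxFunctor.id PrelaxFunctorStruct.id Prefunctor.id
    simp
  naturality_id X := by
    delta Pseudofunctor.comp PrelaxFunctor.comp PrelaxFunctorStruct.comp Prefunctor.comp
    delta Pseudofunctor.id PrelaxFunctor.id PrelaxFunctorStruct.id Prefunctor.id
    simp [Bicategory.unitors_inv_equal, PrelaxFunctor.mapFunctor]
  naturality_comp f g := by
    delta Pseudofunctor.comp PrelaxFunctor.comp PrelaxFunctorStruct.comp Prefunctor.comp
    delta Pseudofunctor.id PrelaxFunctor.id PrelaxFunctorStruct.id Prefunctor.id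
    simp [PrelaxFunctor.mapFunctor]

open Pseudofunctor.StrongTrans (isoMk)

/-- Pre-whiskering of a modification: `ν_F`, with components `ν_{F X}`. -/
def preWhisker₂ (F : A ⥤ᵖ B) {G₁ G₂ : B ⥤ᵖ C} {Ψ₁ Ψ₂ : G₁ ⟶ G₂} (ν : Ψ₁ ⟶ Ψ₂) :
    preWhisker F Ψ₁ ⟶ preWhisker F Ψ₂ where
  as.app X := ν.as.app (F.obj X)
  as.naturality f := ν.as.naturality (F.map f)

/-- Post-whiskering of a modification: `G(μ)`, with components `G(μ_X)`. -/
def postWhisker₂ {F₁ F₂ : A ⥤ᵖ B} {Φ₁ Φ₂ : F₁ ⟶ F₂} (μ : Φ₁ ⟶ Φ₂) (G : B ⥤ᵖ C) :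
    postWhisker Φ₁ G ⟶ postWhisker Φ₂ G where
  as.app X := G.map₂ (μ.as.app X)
  as.naturality f := by
    delta postWhisker Pseudofunctor.comp PrelaxFunctor.comp PrelaxFunctorStruct.comp Prefunctor.comp
    simp [map_whiskerLeft_map₂, map₂_whiskerRight_map, ← PrelaxFunctor.map₂_comp_assoc,
      -PrelaxFunctor.map₂_comp, -Pseudofunctor.map₂_whisker_right, -Pseudofunctor.map₂_whisker_left]

def preWhiskerIso (F : A ⥤ᵖ B) {G₁ G₂ : B ⥤ᵖ C} {Ψ₁ Ψ₂ : G₁ ⟶ G₂} (e : Ψ₁ ≅ Ψ₂) :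
    preWhisker F Ψ₁ ≅ preWhisker F Ψ₂ where
  hom := preWhisker₂ F e.hom
  inv := preWhisker₂ F e.inv
  hom_inv_id := by
    ext X
    exact congrArg (fun m => m.as.app (F.obj X)) e.hom_inv_id
  inv_hom_id := by
    ext X
    exact congrArg (fun m => m.as.app (F.obj X)) e.inv_hom_id

def postWhiskerIso {F₁ F₂ : A ⥤ᵖ B} {Φ₁ Φ₂ : F₁ ⟶ F₂} (e : Φ₁ ≅ Φ₂) (G : B ⥤ᵖ C) :
    postWhisker Φ₁ G ≅ postWhisker Φ₂ G where
  hom := postWhisker₂ e.hom G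
  inv := postWhisker₂ e.inv G
  hom_inv_id := by
    ext X
    exact (G.map₂_comp _ _).symm.trans ((congrArg (fun m => G.map₂ (m.as.app X))
      e.hom_inv_id).trans (G.map₂_id _))
  inv_hom_id := by
    ext X
    exact (G.map₂_comp _ _).symm.trans ((congrArg (fun m => G.map₂ (m.as.app X))
      e.inv_hom_id).trans (G.map₂_id _))

lemma comp_nat {F G H : A ⥤ᵖ B} (η : F ⟶ G) (θ : G ⟶ H) {X Y : A} (f : X ⟶ Y) :
    ((η ≫ θ).naturality f).hom = (α_ (F.map f) (η.app Y) (θ.app Y)).inv ≫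
      (η.naturality f).hom ▷ θ.app Y ≫ (α_ (η.app X) (G.map f) (θ.app Y)).hom ≫
      η.app X ◁ (θ.naturality f).hom ≫ (α_ (η.app X) (θ.app X) (H.map f)).inv := rfl

lemma id_nat (F : A ⥤ᵖ B) {X Y : A} (f : X ⟶ Y) :
    ((𝟙 F : F ⟶ F).naturality f).hom = (ρ_ (F.map f)).hom ≫ (λ_ (F.map f)).inv := rfl

lemma id_comm {X Y Z W : B} {f : X ⟶ Y} {g : Y ⟶ W} {h : X ⟶ Z} {k : Z ⟶ W}
    (θ : f ≫ g ⟶ h ≫ k) : f ◁ 𝟙 g ≫ θ = θ ≫ 𝟙 h ▷ k := by simp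

/-- Pseudofunctoriality of whiskering. -/
def preWhiskerComp (F : A ⥤ᵖ B) {G₁ G₂ G₃ : B ⥤ᵖ C} (Ψ : G₁ ⟶ G₂) (Ψ' : G₂ ⟶ G₃) :
    preWhisker F (Ψ ≫ Ψ') ≅ preWhisker F Ψ ≫ preWhisker F Ψ' :=
  isoMk (fun _ => Iso.refl _) (fun _ => id_comm _)

def preWhiskerId (F : A ⥤ᵖ B) (G : B ⥤ᵖ C) : preWhisker F (𝟙 G) ≅ 𝟙 (F.comp G) :=
  isoMk (fun _ => Iso.refl _) (fun _ => id_comm _)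

lemma postWhisker_comp_nat {F G H : A ⥤ᵖ B} (η : F ⟶ G) (θ : G ⟶ H) (K : B ⥤ᵖ C) {X Y : A}
    (f : X ⟶ Y) : ((postWhisker (η ≫ θ) K).naturality f).hom =
      (K.mapComp (F.map f) (η.app Y ≫ θ.app Y)).inv ≫
      K.map₂ (α_ (F.map f) (η.app Y) (θ.app Y)).inv ≫
      K.map₂ ((η.naturality f).hom ▷ θ.app Y) ≫ K.map₂ (α_ (η.app X) (G.map f) (θ.app Y)).hom ≫
      K.map₂ (η.app X ◁ (θ.naturality f).hom) ≫
      K.map₂ (α_ (η.app X) (θ.app X) (H.map f)).inv ≫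
      (K.mapComp (η.app X ≫ θ.app X) (H.map f)).hom := by
  simp only [← K.map₂_comp_assoc]
  rfl

def postWhiskerComp {F₁ F₂ F₃ : A ⥤ᵖ B} (Φ : F₁ ⟶ F₂) (Φ' : F₂ ⟶ F₃) (G : B ⥤ᵖ C) :
    postWhisker (Φ ≫ Φ') G ≅ postWhisker Φ G ≫ postWhisker Φ' G :=
  isoMk (fun X => G.mapComp (Φ.app X) (Φ'.app X)) (fun f => by
    rw [comp_nat, postWhisker_comp_nat]
    delta postWhisker Pseudofunctor.comp PrelaxFunctor.comp PrelaxFunctorStruct.comp Prefunctor.comp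
    simp [map₂_associator_inv'])

lemma naturality_pair {G₁ G₂ : B ⥤ᵖ C} (Ψ : G₁ ⟶ G₂) {X Y Z : B} (f : X ⟶ Y) (g : Y ⟶ Z)
    {k : G₁.obj X ⟶ G₂.obj Z} (θ : (Ψ.app X ≫ G₂.map f) ≫ G₂.map g ⟶ k) :
    G₁.map f ◁ (Ψ.naturality g).hom ≫ (α_ _ _ _).inv ≫ (Ψ.naturality f).hom ▷ G₂.map g ≫ θ =
      (α_ _ _ _).inv ≫ (G₁.mapComp f g).inv ▷ Ψ.app Z ≫ (Ψ.naturality (f ≫ g)).hom ≫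
        Ψ.app X ◁ (G₂.mapComp f g).hom ≫ (α_ _ _ _).inv ≫ θ := by
  simp [Pseudofunctor.StrongTrans.naturality_comp_hom]

/-- The two ways of composing `Φ` and `Ψ` horizontally; the components are the naturality 2-cells
`Ψ_{Φ_X}`. -/
def interchange {F₁ F₂ : A ⥤ᵖ B} (Φ : F₁ ⟶ F₂) {G₁ G₂ : B ⥤ᵖ C} (Ψ : G₁ ⟶ G₂) :
    postWhisker Φ G₁ ≫ preWhisker F₂ Ψ ≅ preWhisker F₁ Ψ ≫ postWhisker Φ G₂ :=
  isoMk (fun X => Ψ.naturality (Φ.app X)) (fun {X Y} f => by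
    rw [comp_nat, comp_nat]
    delta preWhisker postWhisker Pseudofunctor.comp PrelaxFunctor.comp PrelaxFunctorStruct.comp Prefunctor.comp
    have h := naturality_pair Ψ (Φ.app X) (F₂.map f) (𝟙 _)
    simp only [Category.comp_id] at h
    simp
    rw [naturality_pair, h]
    simp [-Pseudofunctor.StrongTrans.naturality_comp,
      -Pseudofunctor.StrongTrans.naturality_comp_assoc,
      -Pseudofunctor.StrongTrans.naturality_naturality,
      ← Pseudofunctor.StrongTrans.naturality_naturality_assoc])

/-- Pseudonaturality of the unitors, and their compatibility with associators. -/
def toCompIdNat {F₁ F₂ : A ⥤ᵖ B} (Ω : F₁ ⟶ F₂) :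
    Ω ≫ toCompId F₂ ≅ toCompId F₁ ≫ postWhisker Ω (Pseudofunctor.id B) :=
  isoMk (fun X => ρ_ (Ω.app X) ≪≫ (λ_ (Ω.app X)).symm) (fun {X Y} f => by
    rw [comp_nat, comp_nat]
    delta toCompId postWhisker Pseudofunctor.comp PrelaxFunctor.comp
      PrelaxFunctorStruct.comp Prefunctor.comp
    delta Pseudofunctor.id PrelaxFunctor.id PrelaxFunctorStruct.id Prefunctor.id
    simp)

def toIdCompNat {F₁ F₂ : A ⥤ᵖ B} (Ω : F₁ ⟶ F₂) :
    Ω ≫ toIdComp F₂ ≅ toIdComp F₁ ≫ preWhisker (Pseudofunctor.id A) Ω :=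
  isoMk (fun X => ρ_ (Ω.app X) ≪≫ (λ_ (Ω.app X)).symm) (fun {X Y} f => by
    rw [comp_nat, comp_nat]
    delta toIdComp preWhisker Pseudofunctor.comp PrelaxFunctor.comp
      PrelaxFunctorStruct.comp Prefunctor.comp
    delta Pseudofunctor.id PrelaxFunctor.id PrelaxFunctorStruct.id Prefunctor.id
    simp)

def ofIdCompNat {F₁ F₂ : A ⥤ᵖ B} (Ω : F₁ ⟶ F₂) :
    preWhisker (Pseudofunctor.id A) Ω ≫ ofIdComp F₂ ≅ ofIdComp F₁ ≫ Ω :=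
  isoMk (fun X => ρ_ (Ω.app X) ≪≫ (λ_ (Ω.app X)).symm) (fun {X Y} f => by
    rw [comp_nat, comp_nat]
    delta ofIdComp preWhisker Pseudofunctor.comp PrelaxFunctor.comp
      PrelaxFunctorStruct.comp Prefunctor.comp
    delta Pseudofunctor.id PrelaxFunctor.id PrelaxFunctorStruct.id Prefunctor.id
    simp)

def toCompIdAssoc (F : A ⥤ᵖ B) (G : B ⥤ᵖ C) :
    preWhisker F (toCompId G) ≫ assocInv F G (Pseudofunctor.id C) ≅ toCompId (F.comp G) :=
  isoMk (fun X => λ_ (𝟙 (G.obj (F.obj X)))) (fun {X Y} f => by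
    rw [comp_nat]
    delta toCompId preWhisker assocInv Pseudofunctor.comp PrelaxFunctor.comp
      PrelaxFunctorStruct.comp Prefunctor.comp
    delta Pseudofunctor.id PrelaxFunctor.id PrelaxFunctorStruct.id Prefunctor.id
    simp only [Iso.trans_hom, Iso.symm_hom, comp_whiskerRight, Bicategory.whiskerLeft_comp]
    bicategory)

def toIdCompAssoc (F : A ⥤ᵖ B) (G : B ⥤ᵖ C) :
    postWhisker (toIdComp F) G ≫ assocHom (Pseudofunctor.id A) F G ≅ toIdComp (F.comp G) :=
  isoMk (fun X => whiskerRightIso (G.mapId (F.obj X)) (𝟙 (G.obj (F.obj X))) ≪≫ λ_ (𝟙 (G.obj (F.obj X)))) (fun {X Y} f => by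
    rw [comp_nat]
    delta toIdComp postWhisker assocHom Pseudofunctor.comp PrelaxFunctor.comp
      PrelaxFunctorStruct.comp Prefunctor.comp
    delta Pseudofunctor.id PrelaxFunctor.id PrelaxFunctorStruct.id Prefunctor.id
    simp [PrelaxFunctor.mapFunctor, map₂_leftUnitor_inv'])

def toIdMid (F : A ⥤ᵖ B) (G : B ⥤ᵖ C) :
    preWhisker F (toIdComp G) ≅ postWhisker (toCompId F) G ≫ assocHom F (Pseudofunctor.id B) G :=
  isoMk (fun X => (λ_ (𝟙 (G.obj (F.obj X)))).symm ≪≫ whiskerRightIso (G.mapId (F.obj X)).symm (𝟙 (G.obj (F.obj X)))) (fun {X Y} f => by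
    rw [comp_nat]
    delta toIdComp toCompId preWhisker postWhisker assocHom Pseudofunctor.comp PrelaxFunctor.comp
      PrelaxFunctorStruct.comp Prefunctor.comp
    delta Pseudofunctor.id PrelaxFunctor.id PrelaxFunctorStruct.id Prefunctor.id
    simp [PrelaxFunctor.mapFunctor, map₂_leftUnitor_inv'])

/-- The naturality 2-cell of a composite, for the components that occur in the unitor modifications. -/
def natComp {X Y : B} {f : X ⟶ Y} {pX qX : X ⟶ X} {pY qY : Y ⟶ Y} (σ : f ≫ pY ⟶ pX ≫ f)
    (τ : f ≫ qY ⟶ qX ≫ f) : f ≫ pY ≫ qY ⟶ (pX ≫ qX) ≫ f :=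
  (α_ f pY qY).inv ≫ σ ▷ qY ≫ (α_ pX f qY).hom ≫ pX ◁ τ ≫ (α_ pX qX f).inv

lemma natComp_left {X Y : B} {f : X ⟶ Y} {pX qX rX : X ⟶ X} {pY qY rY : Y ⟶ Y}
    (σ : f ≫ pY ⟶ pX ≫ f) {τ : f ≫ qY ⟶ qX ≫ f} {τ' : f ≫ rY ⟶ rX ≫ f} {jX : qX ⟶ rX}
    {jY : qY ⟶ rY} (h : f ◁ jY ≫ τ' = τ ≫ jX ▷ f) :
    f ◁ pY ◁ jY ≫ natComp σ τ' = natComp σ τ ≫ (pX ◁ jX) ▷ f := by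
  have h' := congrArg (fun t => pX ◁ t ≫ (α_ pX rX f).inv) h
  simp only [Bicategory.whiskerLeft_comp, Category.assoc] at h'
  simp only [natComp, Category.assoc]
  rw [associator_inv_naturality_right_assoc, whisker_exchange_assoc,
    associator_naturality_right_assoc, h']
  simp

lemma natComp_right {X Y : B} {f : X ⟶ Y} {pX qX rX : X ⟶ X} {pY qY rY : Y ⟶ Y}
    {σ : f ≫ pY ⟶ pX ≫ f} {σ' : f ≫ rY ⟶ rX ≫ f} (τ : f ≫ qY ⟶ qX ≫ f) {jX : pX ⟶ rX}
    {jY : pY ⟶ rY} (h : f ◁ jY ≫ σ' = σ ≫ jX ▷ f) :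
    f ◁ jY ▷ qY ≫ natComp σ' τ = natComp σ τ ≫ (jX ▷ qX) ▷ f := by
  have h' := congrArg (fun t => t ▷ qY ≫ (α_ rX f qY).hom) h
  simp only [comp_whiskerRight, Category.assoc] at h'
  simp only [natComp, Category.assoc]
  rw [associator_inv_naturality_middle_assoc, reassoc_of% h', associator_naturality_left_assoc,
    ← whisker_exchange_assoc]
  simp

lemma natComp_unit {X Y : B} (f : X ⟶ Y) :
    f ◁ (λ_ (𝟙 Y)).hom ≫ (ρ_ f).hom ≫ (λ_ f).inv =
      natComp ((ρ_ f).hom ≫ (λ_ f).inv) ((ρ_ f).hom ≫ (λ_ f).inv) ≫ (λ_ (𝟙 X)).hom ▷ f := by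
  simp only [natComp, comp_whiskerRight, Bicategory.whiskerLeft_comp]
  bicategory

lemma map_unit (K : B ⥤ᵖ C) {X Y : B} (f : X ⟶ Y) :
    K.map f ◁ (K.mapId Y).hom ≫ (ρ_ (K.map f)).hom ≫ (λ_ (K.map f)).inv =
      ((K.mapComp f (𝟙 Y)).inv ≫ K.map₂ ((ρ_ f).hom ≫ (λ_ f).inv) ≫ (K.mapComp (𝟙 X) f).hom) ≫
        (K.mapId X).hom ▷ K.map f := by
  simp [map₂_leftUnitor_inv']

lemma map_unit' (K : B ⥤ᵖ C) {X Y : B} (f : X ⟶ Y) :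
    K.map f ◁ (K.mapId Y).inv ≫
      ((K.mapComp f (𝟙 Y)).inv ≫ K.map₂ ((ρ_ f).hom ≫ (λ_ f).inv) ≫ (K.mapComp (𝟙 X) f).hom) =
      ((ρ_ (K.map f)).hom ≫ (λ_ (K.map f)).inv) ≫ (K.mapId X).inv ▷ K.map f := by
  simp [map₂_leftUnitor_inv']

lemma nat_trans {X Y : B} {f : X ⟶ Y} {pX qX rX : X ⟶ X} {pY qY rY : Y ⟶ Y}
    {σ : f ≫ pY ⟶ pX ≫ f} {τ : f ≫ qY ⟶ qX ≫ f} {τ' : f ≫ rY ⟶ rX ≫ f} {iX : pX ⟶ qX}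
    {iY : pY ⟶ qY} {jX : qX ⟶ rX} {jY : qY ⟶ rY} (h : f ◁ iY ≫ τ = σ ≫ iX ▷ f)
    (h' : f ◁ jY ≫ τ' = τ ≫ jX ▷ f) : f ◁ (iY ≫ jY) ≫ τ' = σ ≫ (iX ≫ jX) ▷ f := by
  rw [Bicategory.whiskerLeft_comp, Category.assoc, h', comp_whiskerRight, reassoc_of% h]

def assocHomInv (F : A ⥤ᵖ B) (G : B ⥤ᵖ C) (H : C ⥤ᵖ D) :
    assocHom F G H ≫ assocInv F G H ≅ 𝟙 ((F.comp G).comp H) :=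
  isoMk (fun X => λ_ (𝟙 (H.obj (G.obj (F.obj X))))) (fun f => by
    rw [comp_nat, id_nat]
    delta assocHom assocInv Pseudofunctor.comp PrelaxFunctor.comp
      PrelaxFunctorStruct.comp Prefunctor.comp
    simp only [Iso.trans_hom, Iso.symm_hom, comp_whiskerRight, Bicategory.whiskerLeft_comp]
    bicategory)

def ofIdMid (F : A ⥤ᵖ B) (G : B ⥤ᵖ C) :
    assocInv F (Pseudofunctor.id B) G ≫ postWhisker (ofCompId F) G ≅ preWhisker F (ofIdComp G) :=
  isoMk (fun X => whiskerLeftIso (𝟙 (G.obj (F.obj X))) (G.mapId (F.obj X)) ≪≫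
      λ_ (𝟙 (G.obj (F.obj X)))) (fun f =>
    nat_trans (natComp_left _ (map_unit G (F.map f))) (natComp_unit (G.map (F.map f))))

/-- Pseudonaturality of the associators in each of their three variables. -/
def assocInvPre (F : A ⥤ᵖ B) (G : B ⥤ᵖ C) {H₁ H₂ : C ⥤ᵖ D} (Ψ : H₁ ⟶ H₂) :
    preWhisker F (preWhisker G Ψ) ≫ assocInv F G H₂ ≅ assocInv F G H₁ ≫ preWhisker (F.comp G) Ψ :=
  isoMk (fun X => ρ_ (Ψ.app (G.obj (F.obj X))) ≪≫ (λ_ (Ψ.app (G.obj (F.obj X)))).symm) (fun {X Y} f => by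
    rw [comp_nat, comp_nat]
    delta preWhisker assocInv Pseudofunctor.comp PrelaxFunctor.comp
      PrelaxFunctorStruct.comp Prefunctor.comp
    simp)

def assocHomMid (F : A ⥤ᵖ B) {G₁ G₂ : B ⥤ᵖ C} (Ψ : G₁ ⟶ G₂) (H : C ⥤ᵖ D) :
    assocHom F G₁ H ≫ preWhisker F (postWhisker Ψ H) ≅ postWhisker (preWhisker F Ψ) H ≫ assocHom F G₂ H :=
  isoMk (fun X => λ_ (H.map (Ψ.app (F.obj X))) ≪≫ (ρ_ (H.map (Ψ.app (F.obj X)))).symm) (fun {X Y} f => by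
    rw [comp_nat, comp_nat]
    delta preWhisker postWhisker assocHom Pseudofunctor.comp PrelaxFunctor.comp
      PrelaxFunctorStruct.comp Prefunctor.comp
    simp)

def assocInvMid (F : A ⥤ᵖ B) {G₁ G₂ : B ⥤ᵖ C} (Ψ : G₁ ⟶ G₂) (H : C ⥤ᵖ D) :
    assocInv F G₁ H ≫ postWhisker (preWhisker F Ψ) H ≅ preWhisker F (postWhisker Ψ H) ≫ assocInv F G₂ H :=
  isoMk (fun X => λ_ (H.map (Ψ.app (F.obj X))) ≪≫ (ρ_ (H.map (Ψ.app (F.obj X)))).symm) (fun {X Y} f => by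
    rw [comp_nat, comp_nat]
    delta preWhisker postWhisker assocInv Pseudofunctor.comp PrelaxFunctor.comp
      PrelaxFunctorStruct.comp Prefunctor.comp
    simp)

def assocHomPost {F₁ F₂ : A ⥤ᵖ B} (Φ : F₁ ⟶ F₂) (G : B ⥤ᵖ C) (H : C ⥤ᵖ D) :
    assocHom F₁ G H ≫ postWhisker Φ (G.comp H) ≅ postWhisker (postWhisker Φ G) H ≫ assocHom F₂ G H :=
  isoMk (fun X => λ_ (H.map (G.map (Φ.app X))) ≪≫ (ρ_ (H.map (G.map (Φ.app X)))).symm) (fun {X Y} f => by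
    rw [comp_nat, comp_nat]
    delta postWhisker assocHom Pseudofunctor.comp PrelaxFunctor.comp
      PrelaxFunctorStruct.comp Prefunctor.comp
    simp [PrelaxFunctor.mapFunctor])

def assocInvPost {F₁ F₂ : A ⥤ᵖ B} (Φ : F₁ ⟶ F₂) (G : B ⥤ᵖ C) (H : C ⥤ᵖ D) :
    assocInv F₁ G H ≫ postWhisker (postWhisker Φ G) H ≅ postWhisker Φ (G.comp H) ≫ assocInv F₂ G H :=
  isoMk (fun X => λ_ (H.map (G.map (Φ.app X))) ≪≫ (ρ_ (H.map (G.map (Φ.app X)))).symm) (fun {X Y} f => by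
    rw [comp_nat, comp_nat]
    delta postWhisker assocInv Pseudofunctor.comp PrelaxFunctor.comp
      PrelaxFunctorStruct.comp Prefunctor.comp
    simp [PrelaxFunctor.mapFunctor])

/-- Pentagonators (three of the equivalent shapes of the pentagon). -/
def pentagonA (F : A ⥤ᵖ B) (G : B ⥤ᵖ C) (H : C ⥤ᵖ D) (K : D ⥤ᵖ E) :
    assocHom F (G.comp H) K ≫ preWhisker F (assocHom G H K) ≫ assocInv F G (H.comp K) ≅
      postWhisker (assocInv F G H) K ≫ assocHom (F.comp G) H K :=
  isoMk (fun X => whiskerLeftIso (𝟙 (K.obj (H.obj (G.obj (F.obj X))))) (λ_ (𝟙 (K.obj (H.obj (G.obj (F.obj X)))))) ≪≫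
      whiskerRightIso (K.mapId (H.obj (G.obj (F.obj X)))).symm (𝟙 (K.obj (H.obj (G.obj (F.obj X)))))) (fun f =>
    nat_trans (natComp_left _ (natComp_unit (K.map (H.map (G.map (F.map f))))))
      (natComp_right _ (map_unit' K (H.map (G.map (F.map f))))))

def pentagonB (F : A ⥤ᵖ B) (G : B ⥤ᵖ C) (H : C ⥤ᵖ D) (K : D ⥤ᵖ E) :
    preWhisker F (assocInv G H K) ≫ assocInv F (G.comp H) K ≫ postWhisker (assocInv F G H) K ≅
      assocInv F G (H.comp K) ≫ assocInv (F.comp G) H K :=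
  isoMk (fun X => whiskerLeftIso (𝟙 (K.obj (H.obj (G.obj (F.obj X))))) (whiskerLeftIso (𝟙 (K.obj (H.obj (G.obj (F.obj X)))))
      (K.mapId (H.obj (G.obj (F.obj X)))) ≪≫ λ_ (𝟙 (K.obj (H.obj (G.obj (F.obj X))))))) (fun f =>
    natComp_left _ (nat_trans (natComp_left _ (map_unit K (H.map (G.map (F.map f)))))
      (natComp_unit (K.map (H.map (G.map (F.map f)))))))

def pentagonC (F : A ⥤ᵖ B) (G : B ⥤ᵖ C) (H : C ⥤ᵖ D) (K : D ⥤ᵖ E) :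
    assocInv F G (H.comp K) ≫ assocInv (F.comp G) H K ≫ postWhisker (assocHom F G H) K ≅
      preWhisker F (assocInv G H K) ≫ assocInv F (G.comp H) K :=
  isoMk (fun X => whiskerLeftIso (𝟙 (K.obj (H.obj (G.obj (F.obj X))))) (whiskerLeftIso (𝟙 (K.obj (H.obj (G.obj (F.obj X)))))
      (K.mapId (H.obj (G.obj (F.obj X)))) ≪≫ λ_ (𝟙 (K.obj (H.obj (G.obj (F.obj X))))))) (fun f =>
    natComp_left _ (nat_trans (natComp_left _ (map_unit K (H.map (G.map (F.map f)))))
      (natComp_unit (K.map (H.map (G.map (F.map f)))))))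

/-- For `η : Id ⟶ T` and `F`: the whiskering `η_F : F ⟶ T F`. -/
def unitPre {T : B ⥤ᵖ B} (η : Pseudofunctor.id B ⟶ T) (F : A ⥤ᵖ B) : F ⟶ F.comp T :=
  toCompId F ≫ preWhisker F η

/-- For `η : Id ⟶ T` and `F`: the whiskering `F(η) : F ⟶ F T`. -/
def unitPost {T : A ⥤ᵖ A} (η : Pseudofunctor.id A ⟶ T) (F : A ⥤ᵖ B) : F ⟶ T.comp F :=
  toIdComp F ≫ postWhisker η F

/-- For `κ : T ⟶ Id` and `F`: the whiskering `κ_F : T F ⟶ F`. -/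
def counitPre {T : B ⥤ᵖ B} (κ : T ⟶ Pseudofunctor.id B) (F : A ⥤ᵖ B) : F.comp T ⟶ F :=
  preWhisker F κ ≫ ofCompId F

/-- For `κ : T ⟶ Id` and `F`: the whiskering `F(κ) : F T ⟶ F`. -/
def counitPost {T : A ⥤ᵖ A} (κ : T ⟶ Pseudofunctor.id A) (F : A ⥤ᵖ B) : T.comp F ⟶ F :=
  postWhisker κ F ≫ ofIdComp F

def unitPreNat {T : B ⥤ᵖ B} (η : Pseudofunctor.id B ⟶ T) {F₁ F₂ : A ⥤ᵖ B} (Ω : F₁ ⟶ F₂) :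
    Ω ≫ unitPre η F₂ ≅ unitPre η F₁ ≫ postWhisker Ω T :=
  Iso.refl (Ω ≫ toCompId F₂ ≫ preWhisker F₂ η) ≪⊗≫
    whiskerRightIso (toCompIdNat Ω) (preWhisker F₂ η) ≪⊗≫
    whiskerLeftIso (toCompId F₁) (interchange Ω η) ≪⊗≫
    Iso.refl ((toCompId F₁ ≫ preWhisker F₁ η) ≫ postWhisker Ω T)

def unitPostNat {T : A ⥤ᵖ A} (η : Pseudofunctor.id A ⟶ T) {F₁ F₂ : A ⥤ᵖ B} (Ω : F₁ ⟶ F₂) :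
    unitPost η F₁ ≫ preWhisker T Ω ≅ Ω ≫ unitPost η F₂ :=
  Iso.refl ((toIdComp F₁ ≫ postWhisker η F₁) ≫ preWhisker T Ω) ≪⊗≫
    whiskerLeftIso (toIdComp F₁) (interchange η Ω) ≪⊗≫
    whiskerRightIso (toIdCompNat Ω).symm (postWhisker η F₂) ≪⊗≫
    Iso.refl (Ω ≫ toIdComp F₂ ≫ postWhisker η F₂)

def counitPostNat {T : A ⥤ᵖ A} (κ : T ⟶ Pseudofunctor.id A) {F₁ F₂ : A ⥤ᵖ B} (Ω : F₁ ⟶ F₂) :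
    preWhisker T Ω ≫ counitPost κ F₂ ≅ counitPost κ F₁ ≫ Ω :=
  Iso.refl (preWhisker T Ω ≫ postWhisker κ F₂ ≫ ofIdComp F₂) ≪⊗≫
    whiskerRightIso (interchange κ Ω).symm (ofIdComp F₂) ≪⊗≫
    whiskerLeftIso (postWhisker κ F₁) (ofIdCompNat Ω) ≪⊗≫
    Iso.refl ((postWhisker κ F₁ ≫ ofIdComp F₁) ≫ Ω)

def unitPreComp {T T' : B ⥤ᵖ B} (η : Pseudofunctor.id B ⟶ T) (θ : T ⟶ T') (F : A ⥤ᵖ B) :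
    unitPre (η ≫ θ) F ≅ unitPre η F ≫ preWhisker F θ :=
  Iso.refl (toCompId F ≫ preWhisker F (η ≫ θ)) ≪⊗≫
    whiskerLeftIso (toCompId F) (preWhiskerComp F η θ) ≪⊗≫
    Iso.refl ((toCompId F ≫ preWhisker F η) ≫ preWhisker F θ)

def counitPostComp {T T' : A ⥤ᵖ A} (θ : T' ⟶ T) (κ : T ⟶ Pseudofunctor.id A) (F : A ⥤ᵖ B) :
    counitPost (θ ≫ κ) F ≅ postWhisker θ F ≫ counitPost κ F :=
  Iso.refl (postWhisker (θ ≫ κ) F ≫ ofIdComp F) ≪⊗≫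
    whiskerRightIso (postWhiskerComp θ κ F) (ofIdComp F) ≪⊗≫
    Iso.refl (postWhisker θ F ≫ postWhisker κ F ≫ ofIdComp F)

def unitPreAssoc {T : C ⥤ᵖ C} (η : Pseudofunctor.id C ⟶ T) (F : A ⥤ᵖ B) (G : B ⥤ᵖ C) :
    preWhisker F (unitPre η G) ≫ assocInv F G T ≅ unitPre η (F.comp G) :=
  whiskerRightIso (preWhiskerComp F (toCompId G) (preWhisker G η)) (assocInv F G T) ≪⊗≫
    whiskerLeftIso (preWhisker F (toCompId G)) (assocInvPre F G η) ≪⊗≫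
    whiskerRightIso (toCompIdAssoc F G) (preWhisker (F.comp G) η)

def unitPostAssoc {T : A ⥤ᵖ A} (η : Pseudofunctor.id A ⟶ T) (F : A ⥤ᵖ B) (G : B ⥤ᵖ C) :
    postWhisker (unitPost η F) G ≫ assocHom T F G ≅ unitPost η (F.comp G) :=
  whiskerRightIso (postWhiskerComp (toIdComp F) (postWhisker η F) G) (assocHom T F G) ≪⊗≫
    whiskerLeftIso (postWhisker (toIdComp F) G) (assocHomPost η F G).symm ≪⊗≫
    whiskerRightIso (toIdCompAssoc F G) (postWhisker η (F.comp G))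

def unitMidAssoc {T : B ⥤ᵖ B} (η : Pseudofunctor.id B ⟶ T) (F : A ⥤ᵖ B) (G : B ⥤ᵖ C) :
    preWhisker F (unitPost η G) ≅ postWhisker (unitPre η F) G ≫ assocHom F T G :=
  preWhiskerComp F (toIdComp G) (postWhisker η G) ≪⊗≫
    whiskerRightIso (toIdMid F G) (preWhisker F (postWhisker η G)) ≪⊗≫
    whiskerLeftIso (postWhisker (toCompId F) G) (assocHomMid F η G) ≪⊗≫
    whiskerRightIso (postWhiskerComp (toCompId F) (preWhisker F η) G).symm (assocHom F T G)

def counitMidAssoc {T : B ⥤ᵖ B} (κ : T ⟶ Pseudofunctor.id B) (F : A ⥤ᵖ B) (G : B ⥤ᵖ C) :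
    assocInv F T G ≫ postWhisker (counitPre κ F) G ≅ preWhisker F (counitPost κ G) :=
  whiskerLeftIso (assocInv F T G) (postWhiskerComp (preWhisker F κ) (ofCompId F) G) ≪⊗≫
    whiskerRightIso (assocInvMid F κ G) (postWhisker (ofCompId F) G) ≪⊗≫
    whiskerLeftIso (preWhisker F (postWhisker κ G)) (ofIdMid F G) ≪⊗≫
    (preWhiskerComp F (postWhisker κ G) (ofIdComp G)).symm

end Whiskering

section Inverters

variable {C : Type u₁} [Bicategory.{w₁, v₁} C]

/-- The 1-morphisms `f : X ⟶ X₁` such that the whiskering `φ * f` is invertible. -/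
def InvCone {X₁ X₂ : C} {f₁ f₂ : X₁ ⟶ X₂} (φ : f₁ ⟶ f₂) (X : C) : ObjectProperty (X ⟶ X₁) :=
  fun f => IsIso (f ◁ φ)

lemma invCone_comp {X₀ X₁ X₂ : C} {f₁ f₂ : X₁ ⟶ X₂} {φ : f₁ ⟶ f₂} {f₀ : X₀ ⟶ X₁}
    (h : InvCone φ X₀ f₀) {X : C} (g : X ⟶ X₀) : InvCone φ X (g ≫ f₀) := by
  have : IsIso (f₀ ◁ φ) := h
  change IsIso ((g ≫ f₀) ◁ φ)
  rw [comp_whiskerLeft]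
  infer_instance

/-- Composition with an invertible cone `f₀`, as a functor from `Hom(X, X₀)` to the full subcategory of
`Hom(X, X₁)` on the `f` such that `φ * f` is invertible. -/
def invConeLift {X₀ X₁ X₂ : C} {f₁ f₂ : X₁ ⟶ X₂} {φ : f₁ ⟶ f₂} {f₀ : X₀ ⟶ X₁}
    (h : InvCone φ X₀ f₀) (X : C) : (X ⟶ X₀) ⥤ (InvCone φ X).FullSubcategory :=
  (InvCone φ X).lift (postcomp X f₀) (fun g => invCone_comp h g)

/-- `(X₀, f₀)` is an inverter of the 2-morphism `φ : f₁ ⟶ f₂`: the 2-morphism `φ * f₀` is invertible, and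
every `Hom(X, X₀)` is equivalent, through composition with `f₀`, to the category of the
`f : X ⟶ X₁` such that `φ * f` is invertible. -/
structure IsInverter {X₀ X₁ X₂ : C} {f₁ f₂ : X₁ ⟶ X₂} (φ : f₁ ⟶ f₂) (f₀ : X₀ ⟶ X₁) : Prop where
  cone : InvCone φ X₀ f₀
  universal (X : C) : (invConeLift cone X).IsEquivalence

/-- A 1-morphism `f : X ⟶ Y` is fully faithful if `h ↦ f ∘ h`, `Hom(Z, X) ⥤ Hom(Z, Y)`, is fully faithful
for every object `Z`. -/
structure IsFullyFaithful {X Y : C} (f : X ⟶ Y) : Prop where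
  full (Z : C) : (postcomp Z f).Full
  faithful (Z : C) : (postcomp Z f).Faithful

end Inverters

section Biadjunctions

variable {A : Type u₁} [Bicategory.{w₁, v₁} A] {B : Type u₂} [Bicategory.{w₂, v₂} B]
  {C : Type u₃} [Bicategory.{w₃, v₃} C]

/-- A biadjunction `L ⊣ R` between pseudofunctors: a unit, a counit, and invertible modifications for the two
triangle laws. -/
structure Biadjunction (L : B ⥤ᵖ A) (R : A ⥤ᵖ B) where
  unit : Pseudofunctor.id B ⟶ L.comp R
  counit : R.comp L ⟶ Pseudofunctor.id A
  left : unitPost unit L ≫ assocHom L R L ≫ counitPre counit L ≅ 𝟙 L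
  right : unitPre unit R ≫ assocInv R L R ≫ counitPost counit R ≅ 𝟙 R

variable {F : A ⥤ᵖ B} {G : B ⥤ᵖ C} {H : A ⥤ᵖ C} {L : B ⥤ᵖ A} {N : C ⥤ᵖ A}

/-- The unit `Γ⁻¹_N ∘ Ψ` of the biadjunction `N ⊣ G F` obtained from `N ⊣ H` and `Γ : G F ≃ H`. -/
def psi' (adjH : Biadjunction N H) (Γ : F.comp G ≌ H) :
    Pseudofunctor.id C ⟶ N.comp (F.comp G) :=
  adjH.unit ≫ preWhisker N Γ.inv

/-- The counit `Υ ∘ N(Γ)` of the biadjunction `N ⊣ G F`. -/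
def upsilon' (adjH : Biadjunction N H) (Γ : F.comp G ≌ H) :
    (F.comp G).comp N ⟶ Pseudofunctor.id A :=
  postWhisker Γ.hom N ≫ adjH.counit

/-- `Φ' : G ⟶ G (F L) ≅ (G F) L`. -/
def phi' (adjF : Biadjunction L F) (G : B ⥤ᵖ C) : G ⟶ L.comp (F.comp G) :=
  unitPost adjF.unit G ≫ assocHom L F G

/-- `Θ : N G ⟶ N ((G F) L) ≅ (N (G F)) L ⟶ L`, composed of `N(Φ')`, an associator and `Υ'_L`. -/
def theta (adjF : Biadjunction L F) (adjH : Biadjunction N H) (Γ : F.comp G ≌ H) :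
    G.comp N ⟶ L :=
  postWhisker (phi' adjF G) N ≫ assocHom L (F.comp G) N ≫ counitPre (upsilon' adjH Γ) L

/-- `Θ' : (F N) G ≅ F (N G) ⟶ F L`, whose second arrow is `F(Θ)`. -/
def theta' (adjF : Biadjunction L F) (adjH : Biadjunction N H) (Γ : F.comp G ≌ H) :
    G.comp (N.comp F) ⟶ L.comp F :=
  assocInv G N F ≫ postWhisker (theta adjF adjH Γ) F

/-- `Ψ'' : Id ⟶ (G F) N ≅ G (F N)`. -/
def psi'' (adjH : Biadjunction N H) (Γ : F.comp G ≌ H) :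
    Pseudofunctor.id C ⟶ (N.comp F).comp G :=
  psi' adjH Γ ≫ assocInv N F G

/-- `Ξ' : F N ⟶ (F N) (G (F N)) ≅ ((F N) G) (F N)`, whose first arrow is `(F N)(Ψ'')`. -/
def xi' (adjH : Biadjunction N H) (Γ : F.comp G ≌ H) :
    N.comp F ⟶ (N.comp F).comp (G.comp (N.comp F)) :=
  unitPost (psi'' adjH Γ) (N.comp F) ≫ assocHom (N.comp F) G (N.comp F)

/-- `Ξ = Θ'_{F N} ∘ Ξ' : F N ⟶ (F L) (F N)`. -/
def xi (adjF : Biadjunction L F) (adjH : Biadjunction N H) (Γ : F.comp G ≌ H) :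
    N.comp F ⟶ (N.comp F).comp (L.comp F) :=
  xi' adjH Γ ≫ preWhisker (N.comp F) (theta' adjF adjH Γ)

/-- `Θ'' : ((F L) (F N)) G ≅ (F L) ((F N) G) ⟶ (F L) (F L)`, whose second arrow is `(F L)(Θ')`. -/
def theta'' (adjF : Biadjunction L F) (adjH : Biadjunction N H) (Γ : F.comp G ≌ H) :
    G.comp ((N.comp F).comp (L.comp F)) ⟶ (L.comp F).comp (L.comp F) :=
  assocInv G (N.comp F) (L.comp F) ≫ postWhisker (theta' adjF adjH Γ) (L.comp F)

/-- The invertible modification `Θ'' ∘ (Φ_{F N})_G ≅ Φ_{F L} ∘ Θ'`: an associativity of whiskering followed by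
the pseudonaturality 2-cell `Φ_{Θ'}`. -/
def phi₁ (adjF : Biadjunction L F) (adjH : Biadjunction N H) (Γ : F.comp G ≌ H) :
    preWhisker G (unitPre adjF.unit (N.comp F)) ≫ theta'' adjF adjH Γ ≅
      theta' adjF adjH Γ ≫ unitPre adjF.unit (L.comp F) :=
  Iso.refl (preWhisker G (unitPre adjF.unit (N.comp F)) ≫
      assocInv G (N.comp F) (L.comp F) ≫ postWhisker (theta' adjF adjH Γ) (L.comp F)) ≪⊗≫
    whiskerRightIso (unitPreAssoc adjF.unit G (N.comp F))
      (postWhisker (theta' adjF adjH Γ) (L.comp F)) ≪⊗≫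
    (unitPreNat adjF.unit (theta' adjF adjH Γ)).symm

/-- The right triangle law of `N ⊣ G F`, with unit `Γ⁻¹_N ∘ Ψ` and counit `Υ ∘ N(Γ)`, deduced from the one of
`N ⊣ H` and from the unit of the equivalence `Γ`. -/
def rightTriangle (adjH : Biadjunction N H) (Γ : F.comp G ≌ H) :
    unitPre (psi' adjH Γ) (F.comp G) ≫ assocInv (F.comp G) N (F.comp G) ≫
      counitPost (upsilon' adjH Γ) (F.comp G) ≅ 𝟙 (F.comp G) :=
  whiskerRightIso (unitPreComp adjH.unit (preWhisker N Γ.inv) (F.comp G)) _ ≪≫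
    whiskerLeftIso _ (whiskerLeftIso _
      (counitPostComp (postWhisker Γ.hom N) adjH.counit (F.comp G))) ≪⊗≫
    whiskerLeftIso (unitPre adjH.unit (F.comp G)) (whiskerRightIso
      (assocInvPre (F.comp G) N Γ.inv)
      (postWhisker (postWhisker Γ.hom N) (F.comp G) ≫ counitPost adjH.counit (F.comp G))) ≪⊗≫
    whiskerLeftIso (unitPre adjH.unit (F.comp G) ≫ assocInv (F.comp G) N H)
      (whiskerRightIso (interchange (postWhisker Γ.hom N) Γ.inv).symm
        (counitPost adjH.counit (F.comp G))) ≪⊗≫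
    whiskerLeftIso (unitPre adjH.unit (F.comp G))
      (whiskerRightIso (assocInvPost Γ.hom N H)
        (preWhisker (H.comp N) Γ.inv ≫ counitPost adjH.counit (F.comp G))) ≪⊗≫
    whiskerRightIso (unitPreNat adjH.unit Γ.hom).symm
      (assocInv H N H ≫ preWhisker (H.comp N) Γ.inv ≫ counitPost adjH.counit (F.comp G)) ≪⊗≫
    whiskerLeftIso (Γ.hom ≫ unitPre adjH.unit H ≫ assocInv H N H)
      (counitPostNat adjH.counit Γ.inv) ≪⊗≫
    whiskerLeftIso Γ.hom (whiskerRightIso adjH.right Γ.inv) ≪⊗≫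
    Γ.unit.symm

/-- The right triangle law of `N ⊣ G F` whiskered by `L`, up to associativity:
`(G F)(Υ'_L) ∘ A ∘ A ∘ Ψ'_{(G F) L} ≅ Id`. -/
def triangleAtL (adjH : Biadjunction N H) (Γ : F.comp G ≌ H) (L : B ⥤ᵖ A) :
    unitPre (psi' adjH Γ) (L.comp (F.comp G)) ≫ assocInv (L.comp (F.comp G)) N (F.comp G) ≫
      postWhisker (assocHom L (F.comp G) N) (F.comp G) ≫
      postWhisker (counitPre (upsilon' adjH Γ) L) (F.comp G) ≅ 𝟙 (L.comp (F.comp G)) :=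
  whiskerRightIso (unitPreAssoc (psi' adjH Γ) L (F.comp G)).symm
      (assocInv (L.comp (F.comp G)) N (F.comp G) ≫
        postWhisker (assocHom L (F.comp G) N) (F.comp G) ≫
        postWhisker (counitPre (upsilon' adjH Γ) L) (F.comp G)) ≪⊗≫
    whiskerLeftIso (preWhisker L (unitPre (psi' adjH Γ) (F.comp G)))
      (whiskerRightIso (pentagonC L (F.comp G) N (F.comp G))
        (postWhisker (counitPre (upsilon' adjH Γ) L) (F.comp G))) ≪⊗≫
    whiskerLeftIso (preWhisker L (unitPre (psi' adjH Γ) (F.comp G)) ≫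
        preWhisker L (assocInv (F.comp G) N (F.comp G)))
      (counitMidAssoc (upsilon' adjH Γ) L (F.comp G)) ≪⊗≫
    whiskerLeftIso (preWhisker L (unitPre (psi' adjH Γ) (F.comp G)))
      (preWhiskerComp L (assocInv (F.comp G) N (F.comp G))
        (counitPost (upsilon' adjH Γ) (F.comp G))).symm ≪⊗≫
    (preWhiskerComp L (unitPre (psi' adjH Γ) (F.comp G))
      (assocInv (F.comp G) N (F.comp G) ≫ counitPost (upsilon' adjH Γ) (F.comp G))).symm ≪≫
    preWhiskerIso L (rightTriangle adjH Γ) ≪≫ preWhiskerId L (F.comp G)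

/-- `(G F)(Θ)` expanded according to the definition of `Θ`. -/
def postWhiskerTheta (adjF : Biadjunction L F) (adjH : Biadjunction N H) (Γ : F.comp G ≌ H) :
    postWhisker (theta adjF adjH Γ) (F.comp G) ≅
      postWhisker (postWhisker (phi' adjF G) N) (F.comp G) ≫
        postWhisker (assocHom L (F.comp G) N) (F.comp G) ≫
        postWhisker (counitPre (upsilon' adjH Γ) L) (F.comp G) :=
  postWhiskerComp (postWhisker (phi' adjF G) N)
      (assocHom L (F.comp G) N ≫ counitPre (upsilon' adjH Γ) L) (F.comp G) ≪≫
    whiskerLeftIso (postWhisker (postWhisker (phi' adjF G) N) (F.comp G))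
      (postWhiskerComp (assocHom L (F.comp G) N) (counitPre (upsilon' adjH Γ) L) (F.comp G))

/-- `A ∘ Φ' ≅ G(Φ)`. -/
def phi'Assoc (adjF : Biadjunction L F) (G : B ⥤ᵖ C) :
    phi' adjF G ≫ assocInv L F G ≅ unitPost adjF.unit G :=
  Iso.refl ((unitPost adjF.unit G ≫ assocHom L F G) ≫ assocInv L F G) ≪⊗≫
    whiskerLeftIso (unitPost adjF.unit G) (assocHomInv L F G) ≪⊗≫
    Iso.refl (unitPost adjF.unit G)

/-- `G(Θ') ∘ A ∘ Ψ''_G ≅ G(Φ)`: expand `Ψ''` and `Θ'`, apply a pentagon, exchange the order of whiskering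
of `Φ'`, and use the right triangle law of `N ⊣ G F`. -/
def phi₂'' (adjF : Biadjunction L F) (adjH : Biadjunction N H) (Γ : F.comp G ≌ H) :
    unitPre (psi'' adjH Γ) G ≫ assocInv G (N.comp F) G ≫ postWhisker (theta' adjF adjH Γ) G ≅
      unitPost adjF.unit G :=
  whiskerRightIso (unitPreComp (psi' adjH Γ) (assocInv N F G) G)
      (assocInv G (N.comp F) G ≫ postWhisker (theta' adjF adjH Γ) G) ≪≫
    whiskerLeftIso (unitPre (psi' adjH Γ) G ≫ preWhisker G (assocInv N F G))
      (whiskerLeftIso (assocInv G (N.comp F) G)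
        (postWhiskerComp (assocInv G N F) (postWhisker (theta adjF adjH Γ) F) G)) ≪⊗≫
    whiskerLeftIso (unitPre (psi' adjH Γ) G) (whiskerRightIso (pentagonB G N F G)
      (postWhisker (postWhisker (theta adjF adjH Γ) F) G)) ≪⊗≫
    whiskerLeftIso (unitPre (psi' adjH Γ) G ≫ assocInv G N (F.comp G))
      (assocInvPost (theta adjF adjH Γ) F G) ≪⊗≫
    whiskerLeftIso (unitPre (psi' adjH Γ) G ≫ assocInv G N (F.comp G))
      (whiskerRightIso
        (postWhiskerTheta adjF adjH Γ)
        (assocInv L F G)) ≪⊗≫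
    whiskerLeftIso (unitPre (psi' adjH Γ) G)
      (whiskerRightIso (assocInvPost (phi' adjF G) N (F.comp G))
        (postWhisker (assocHom L (F.comp G) N) (F.comp G) ≫
          postWhisker (counitPre (upsilon' adjH Γ) L) (F.comp G) ≫ assocInv L F G)) ≪⊗≫
    whiskerRightIso (unitPreNat (psi' adjH Γ) (phi' adjF G)).symm
      (assocInv (L.comp (F.comp G)) N (F.comp G) ≫
        postWhisker (assocHom L (F.comp G) N) (F.comp G) ≫
        postWhisker (counitPre (upsilon' adjH Γ) L) (F.comp G) ≫ assocInv L F G) ≪⊗≫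
    whiskerLeftIso (phi' adjF G) (whiskerRightIso (triangleAtL adjH Γ L) (assocInv L F G)) ≪⊗≫
    phi'Assoc adjF G

/-- `((F N) G)(Θ') ∘ A ∘ Ξ'_G ≅ A ∘ (F N)(G(Θ') ∘ A ∘ Ψ''_G)`, by associativity of whiskering and a
pentagonator. -/
def phi₂' (adjF : Biadjunction L F) (adjH : Biadjunction N H) (Γ : F.comp G ≌ H) :
    preWhisker G (xi' adjH Γ) ≫ assocInv G (N.comp F) (G.comp (N.comp F)) ≫
        postWhisker (theta' adjF adjH Γ) (G.comp (N.comp F)) ≅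
      postWhisker (unitPre (psi'' adjH Γ) G ≫ assocInv G (N.comp F) G ≫
        postWhisker (theta' adjF adjH Γ) G) (N.comp F) ≫ assocHom (L.comp F) G (N.comp F) :=
  whiskerRightIso
      (preWhiskerComp G (unitPost (psi'' adjH Γ) (N.comp F)) (assocHom (N.comp F) G (N.comp F)) ≪≫
        whiskerRightIso (unitMidAssoc (psi'' adjH Γ) G (N.comp F))
          (preWhisker G (assocHom (N.comp F) G (N.comp F))))
      (assocInv G (N.comp F) (G.comp (N.comp F)) ≫
        postWhisker (theta' adjF adjH Γ) (G.comp (N.comp F))) ≪⊗≫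
    whiskerLeftIso (postWhisker (unitPre (psi'' adjH Γ) G) (N.comp F))
      (whiskerRightIso (pentagonA G (N.comp F) G (N.comp F))
        (postWhisker (theta' adjF adjH Γ) (G.comp (N.comp F)))) ≪⊗≫
    whiskerLeftIso (postWhisker (unitPre (psi'' adjH Γ) G) (N.comp F) ≫
        postWhisker (assocInv G (N.comp F) G) (N.comp F))
      (assocHomPost (theta' adjF adjH Γ) G (N.comp F)) ≪⊗≫
    whiskerLeftIso (postWhisker (unitPre (psi'' adjH Γ) G) (N.comp F))
      (whiskerRightIso (postWhiskerComp (assocInv G (N.comp F) G)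
        (postWhisker (theta' adjF adjH Γ) G) (N.comp F)).symm
        (assocHom (L.comp F) G (N.comp F))) ≪⊗≫
    whiskerRightIso (postWhiskerComp (unitPre (psi'' adjH Γ) G)
      (assocInv G (N.comp F) G ≫ postWhisker (theta' adjF adjH Γ) G) (N.comp F)).symm
      (assocHom (L.comp F) G (N.comp F))

/-- The invertible modification `Θ'' ∘ Ξ_G ≅ (F L)(Φ) ∘ Θ'`: associativity of whiskering, the interchange
2-cell `Θ'_{Θ'}`, the two preceding modifications and the interchange 2-cell `Θ'_Φ`. -/
def phi₂ (adjF : Biadjunction L F) (adjH : Biadjunction N H) (Γ : F.comp G ≌ H) :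
    preWhisker G (xi adjF adjH Γ) ≫ theta'' adjF adjH Γ ≅
      theta' adjF adjH Γ ≫ unitPost adjF.unit (L.comp F) :=
  whiskerRightIso (preWhiskerComp G (xi' adjH Γ)
      (preWhisker (N.comp F) (theta' adjF adjH Γ))) (theta'' adjF adjH Γ) ≪≫
    Iso.refl ((preWhisker G (xi' adjH Γ) ≫
        preWhisker G (preWhisker (N.comp F) (theta' adjF adjH Γ))) ≫
      assocInv G (N.comp F) (L.comp F) ≫ postWhisker (theta' adjF adjH Γ) (L.comp F)) ≪⊗≫
    whiskerLeftIso (preWhisker G (xi' adjH Γ))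
      (whiskerRightIso (assocInvPre G (N.comp F) (theta' adjF adjH Γ))
        (postWhisker (theta' adjF adjH Γ) (L.comp F))) ≪⊗≫
    whiskerLeftIso (preWhisker G (xi' adjH Γ) ≫ assocInv G (N.comp F) (G.comp (N.comp F)))
      (interchange (theta' adjF adjH Γ) (theta' adjF adjH Γ)).symm ≪⊗≫
    whiskerRightIso
      (phi₂' adjF adjH Γ ≪≫
        whiskerRightIso (postWhiskerIso (phi₂'' adjF adjH Γ) (N.comp F))
          (assocHom (L.comp F) G (N.comp F)) ≪≫
        unitPostAssoc adjF.unit G (N.comp F))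
      (preWhisker (L.comp F) (theta' adjF adjH Γ)) ≪⊗≫
    unitPostNat adjF.unit (theta' adjF adjH Γ)

end Biadjunctions

end BiadjTriangle

open BiadjTriangle

universe w₁ w₂ w₃ v₁ v₂ v₃ u₁ u₂ u₃

namespace BiadjTriangle

/-! ### Further coherence cells for whiskering: cancelling unitors, composing units and counits. -/

section Whiskering

variable {A : Type u₁} [Bicategory.{w₁, v₁} A] {B : Type u₂} [Bicategory.{w₂, v₂} B]
  {C : Type u₃} [Bicategory.{w₃, v₃} C]

open Pseudofunctor.StrongTrans (isoMk)

/-! The unit and counit of `M ⊣ G` come from the universal properties of the two inverters. Since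
`G(μ) * Ψ''` is invertible, `Ψ''` factors through the inverter `G(Λ)` as `G(Λ) ∘ η ≅ Ψ''`. Since `Φ`
is the inverter of `ν`, a factorisation `Φ ∘ κ ≅ Θ' ∘ Λ_G` exists once `ν * (Θ' ∘ Λ_G)` is
invertible. The compatibility of `μ` with `ν` says that `ν * Θ'` is `Θ'' * μ_G` up to the invertible
`phi₁` and `phi₂`, and `μ_G` becomes invertible on `Λ_G` because `μ * Λ` is invertible
(`isIso_whiskerLeft_nu`).

A biadjunction requires only that invertible modifications for the triangle laws exist, with no
further equations between them. Each law can therefore be checked after composition with a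
1-morphism that reflects isomorphy. For the right law this is `G(Φ)`: replacing `Φ ∘ κ` and then
`G(Λ) ∘ η` by what they lift turns the composite into the source of `phi₂''`, hence into `G(Φ)`
(`rightTriangleLift`). For the left law it is `Λ` followed by `Φ_{F N}`: the same replacements turn
the composite into `Ξ ∘ Λ` (`leftTriangleLift`), and the inverse of `μ * Λ` leads back to `Φ_{F N} ∘
Λ`. -/

/-- The two unitors between `F ∘ Id` and `F` are inverse to each other. -/
def ofIdCompToIdComp (F : A ⥤ᵖ B) :
    ofIdComp F ≫ toIdComp F ≅ 𝟙 ((Pseudofunctor.id A).comp F) :=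
  -- Both unitors have the same naturality cell `ρ ≫ λ⁻¹`, so the cell of their composite is
  -- definitionally the `natComp` of two copies of it.
  isoMk (fun X => λ_ (𝟙 (F.obj X))) (fun f => natComp_unit (F.map f))

/-- The two unitors between `Id ∘ F` and `F` are inverse to each other. -/
def ofCompIdToCompId (F : A ⥤ᵖ B) :
    ofCompId F ≫ toCompId F ≅ 𝟙 (F.comp (Pseudofunctor.id B)) :=
  isoMk (fun X => λ_ (𝟙 (F.obj X))) (fun f => natComp_unit (F.map f))

/-- Pseudonaturality of the associator in the outermost pseudofunctor. -/
def assocHomPre {D : Type u₄} [Bicategory.{w₄, v₄} D] (F : A ⥤ᵖ B) (G : B ⥤ᵖ C)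
    {H₁ H₂ : C ⥤ᵖ D} (Ψ : H₁ ⟶ H₂) :
    assocHom F G H₁ ≫ preWhisker F (preWhisker G Ψ) ≅
      preWhisker (F.comp G) Ψ ≫ assocHom F G H₂ :=
  isoMk (fun X => λ_ (Ψ.app (G.obj (F.obj X))) ≪≫ (ρ_ (Ψ.app (G.obj (F.obj X)))).symm)
    (fun {X Y} f => by
      rw [comp_nat, comp_nat]
      delta preWhisker assocHom Pseudofunctor.comp PrelaxFunctor.comp
        PrelaxFunctorStruct.comp Prefunctor.comp
      simp)

/-- Isomorphic units have isomorphic whiskerings `η_F`. -/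
def unitPreIso {T : B ⥤ᵖ B} {η η' : Pseudofunctor.id B ⟶ T} (e : η ≅ η') (F : A ⥤ᵖ B) :
    unitPre η F ≅ unitPre η' F :=
  whiskerLeftIso (toCompId F) (preWhiskerIso F e)

/-- Isomorphic units have isomorphic whiskerings `F(η)`. -/
def unitPostIso {T : A ⥤ᵖ A} {η η' : Pseudofunctor.id A ⟶ T} (e : η ≅ η') (F : A ⥤ᵖ B) :
    unitPost η F ≅ unitPost η' F :=
  whiskerLeftIso (toIdComp F) (postWhiskerIso e F)

/-- `F(η)` followed by `F(θ)` is `F(θ ∘ η)`. -/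
def unitPostComp {T T' : A ⥤ᵖ A} (η : Pseudofunctor.id A ⟶ T) (θ : T ⟶ T') (F : A ⥤ᵖ B) :
    unitPost (η ≫ θ) F ≅ unitPost η F ≫ postWhisker θ F :=
  -- The outer `Iso.refl` terms unfold the whiskerings and fix the bracketing; `≪⊗≫` supplies the
  -- structural associators and unitors of the bicategory of pseudofunctors. The associators
  -- `assocHom` and `assocInv` are genuine 1-morphisms there and have to be moved by explicit cells.
  Iso.refl (toIdComp F ≫ postWhisker (η ≫ θ) F) ≪⊗≫
    whiskerLeftIso (toIdComp F) (postWhiskerComp η θ F) ≪⊗≫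
    Iso.refl ((toIdComp F ≫ postWhisker η F) ≫ postWhisker θ F)

/-- `F(κ)` followed by `F(η)` is `F(η ∘ κ)`. -/
def counitPostUnitPost {S T : A ⥤ᵖ A} (κ : S ⟶ Pseudofunctor.id A) (η : Pseudofunctor.id A ⟶ T)
    (F : A ⥤ᵖ B) : counitPost κ F ≫ unitPost η F ≅ postWhisker (κ ≫ η) F :=
  Iso.refl ((postWhisker κ F ≫ ofIdComp F) ≫ toIdComp F ≫ postWhisker η F) ≪⊗≫
    whiskerLeftIso (postWhisker κ F)
      (whiskerRightIso (ofIdCompToIdComp F) (postWhisker η F)) ≪⊗≫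
    (postWhiskerComp κ η F).symm

/-- `κ_F` followed by `η_F` is `(η ∘ κ)_F`. -/
def counitPreUnitPre {S T : B ⥤ᵖ B} (κ : S ⟶ Pseudofunctor.id B) (η : Pseudofunctor.id B ⟶ T)
    (F : A ⥤ᵖ B) : counitPre κ F ≫ unitPre η F ≅ preWhisker F (κ ≫ η) :=
  Iso.refl ((preWhisker F κ ≫ ofCompId F) ≫ toCompId F ≫ preWhisker F η) ≪⊗≫
    whiskerLeftIso (preWhisker F κ)
      (whiskerRightIso (ofCompIdToCompId F) (preWhisker F η)) ≪⊗≫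
    (preWhiskerComp F κ η).symm

/-- Precomposition with `F` preserves invertible modifications and respects composition up to
`preWhiskerComp`, so `ν_F * Λ_F` is a conjugate of `(ν * Λ)_F`. This carries the invertibility of `μ
* Λ` over to `μ_G * Λ_G`. -/
lemma isIso_whiskerLeft_preWhisker₂ (F : A ⥤ᵖ B) {G₀ G₁ G₂ : B ⥤ᵖ C} (Λ : G₀ ⟶ G₁)
    {Ψ₁ Ψ₂ : G₁ ⟶ G₂} (ν : Ψ₁ ⟶ Ψ₂) (h : IsIso (Λ ◁ ν)) :
    IsIso (preWhisker F Λ ◁ preWhisker₂ F ν) := by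
  have e : preWhisker F Λ ◁ preWhisker₂ F ν =
      ((preWhiskerComp F Λ Ψ₁).symm ≪≫ preWhiskerIso F (asIso (Λ ◁ ν)) ≪≫
        preWhiskerComp F Λ Ψ₂).hom := by
    ext X
    -- The components of `preWhiskerComp` are identities, so at `X` both sides are the component of
    -- `ν * Λ` at `F X`.
    exact ((Category.id_comp _).trans (Category.comp_id _)).symm
  rw [e]
  infer_instance

end Whiskering

/-! ### Reflection of isomorphy and lifting along inverters and fully faithful 1-morphisms. -/

section Inverters

variable {C : Type u₁} [Bicategory.{w₁, v₁} C]

/-- A fully faithful 1-morphism reflects isomorphy of 1-morphisms. -/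
lemma IsFullyFaithful.nonempty_iso {X Y Z : C} {f : X ⟶ Y} (hf : IsFullyFaithful f)
    {g h : Z ⟶ X} (e : g ≫ f ≅ h ≫ f) : Nonempty (g ≅ h) := by
  have := hf.full Z
  have := hf.faithful Z
  exact ⟨(postcomp Z f).preimageIso e⟩

variable {X₀ X₁ X₂ : C} {f₁ f₂ : X₁ ⟶ X₂} {φ : f₁ ⟶ f₂} {f₀ : X₀ ⟶ X₁}

/-- The 1-morphism of an inverter reflects isomorphy of 1-morphisms. -/
lemma IsInverter.nonempty_iso (hf : IsInverter φ f₀) {Z : C} {g h : Z ⟶ X₀}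
    (e : g ≫ f₀ ≅ h ≫ f₀) : Nonempty (g ≅ h) := by
  have := hf.universal Z
  -- The cones form a full subcategory, so `e` is already an isomorphism of cones, and the
  -- equivalence of the universal property reflects it.
  exact ⟨(invConeLift hf.cone Z).preimageIso ((InvCone φ Z).isoMk e)⟩

/-- Every 1-morphism that inverts `φ` factors through the inverter of `φ`. -/
lemma IsInverter.exists_lift (hf : IsInverter φ f₀) {Z : C} (g : Z ⟶ X₁)
    (hg : IsIso (g ◁ φ)) : ∃ l : Z ⟶ X₀, Nonempty (l ≫ f₀ ≅ g) := by
  have := hf.universal Z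
  exact ⟨(invConeLift hf.cone Z).objPreimage ⟨g, hg⟩,
    ⟨(InvCone φ Z).ι.mapIso ((invConeLift hf.cone Z).objObjPreimageIso ⟨g, hg⟩)⟩⟩

end Inverters

/-! ### Existence of the counit, and the two triangle laws after composition. -/

section Triangles

variable {A : Type u₁} [Bicategory.{w₁, v₁} A] {B : Type u₂} [Bicategory.{w₂, v₂} B]
  {C : Type u₃} [Bicategory.{w₃, v₃} C]
  {F : A ⥤ᵖ B} {G : B ⥤ᵖ C} {H : A ⥤ᵖ C} {Γ : F.comp G ≌ H} {L : B ⥤ᵖ A}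
  {adjF : Biadjunction L F} {N : C ⥤ᵖ A} {adjH : Biadjunction N H}
  {M : C ⥤ᵖ B} {Λ : M ⟶ N.comp F}

/-- If `μ * Λ` is invertible, then `Θ' ∘ Λ_G` inverts `ν`. -/
lemma isIso_whiskerLeft_nu {μ : unitPre adjF.unit (N.comp F) ⟶ xi adjF adjH Γ}
    {ν : unitPre adjF.unit (L.comp F) ⟶ unitPost adjF.unit (L.comp F)}
    (hμν : preWhisker₂ G μ ▷ theta'' adjF adjH Γ ≫ (phi₂ adjF adjH Γ).hom =
      (phi₁ adjF adjH Γ).hom ≫ theta' adjF adjH Γ ◁ ν) (h : IsIso (Λ ◁ μ)) :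
    IsIso ((preWhisker G Λ ≫ theta' adjF adjH Γ) ◁ ν) := by
  have h₁ := isIso_whiskerLeft_preWhisker₂ G Λ μ h
  have h₂ : IsIso (preWhisker G Λ ◁ preWhisker₂ G μ ▷ theta'' adjF adjH Γ) := by
    -- Naturality of the associator regroups the double whiskering so that `μ_G * Λ_G` appears as a
    -- factor and `h₁` applies; the extra associator is then cancelled.
    have : IsIso (preWhisker G Λ ◁ preWhisker₂ G μ ▷ theta'' adjF adjH Γ ≫ (α_ _ _ _).inv) := by
      rw [associator_inv_naturality_middle]
      infer_instance
    exact IsIso.of_isIso_comp_right _ (α_ _ _ _).inv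
  -- Solved for `ν * Θ'`, the compatibility exhibits it as `Θ'' * μ_G` between two invertible
  -- modifications.
  rw [← Iso.inv_comp_eq] at hμν
  rw [comp_whiskerLeft, ← hμν, Bicategory.whiskerLeft_comp, Bicategory.whiskerLeft_comp]
  infer_instance

/-- The right triangle law for a unit `η` that lifts `Ψ''` along `G(Λ)` and a counit `κ` that lifts
`Θ' ∘ Λ_G` along `Φ`, after composition with `G(Φ)`. -/
def rightTriangleLift {η : Pseudofunctor.id C ⟶ M.comp G} {κ : G.comp M ⟶ Pseudofunctor.id B}
    (eη : η ≫ postWhisker Λ G ≅ psi'' adjH Γ)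
    (eκ : κ ≫ adjF.unit ≅ preWhisker G Λ ≫ theta' adjF adjH Γ) :
    (unitPre η G ≫ assocInv G M G ≫ counitPost κ G) ≫ unitPost adjF.unit G ≅
      𝟙 G ≫ unitPost adjF.unit G :=
  Iso.refl _ ≪⊗≫
    whiskerLeftIso (unitPre η G ≫ assocInv G M G)
      -- `G(κ)` followed by `G(Φ)` is `G(Φ ∘ κ)`, where the defining property of `κ` can be
      -- substituted.
      (counitPostUnitPost κ adjF.unit G ≪≫ postWhiskerIso eκ G ≪≫
        postWhiskerComp (preWhisker G Λ) (theta' adjF adjH Γ) G) ≪⊗≫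
    whiskerLeftIso (unitPre η G)
      -- Sliding `Λ` back across the associator places `G(Λ)_G` directly after `η_G`, ready for the
      -- defining property of `η`.
      (whiskerRightIso (assocInvMid G Λ G) (postWhisker (theta' adjF adjH Γ) G)) ≪⊗≫
    whiskerRightIso
      ((unitPreComp η (postWhisker Λ G) G).symm ≪≫
        unitPreIso eη G)
      (assocInv G (N.comp F) G ≫ postWhisker (theta' adjF adjH Γ) G) ≪≫
    -- The right triangle law of `N ⊣ G F` enters here, through `phi₂''`.
    phi₂'' adjF adjH Γ ≪⊗≫ Iso.refl _

/-- The left triangle law for a unit `η` that lifts `Ψ''` along `G(Λ)` and a counit `κ` that lifts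
`Θ' ∘ Λ_G` along `Φ`, after composition with `Φ_{F N} ∘ Λ`. -/
def leftTriangleLift {η : Pseudofunctor.id C ⟶ M.comp G} {κ : G.comp M ⟶ Pseudofunctor.id B}
    (eη : η ≫ postWhisker Λ G ≅ psi'' adjH Γ)
    (eκ : κ ≫ adjF.unit ≅ preWhisker G Λ ≫ theta' adjF adjH Γ) :
    (unitPost η M ≫ assocHom M G M ≫ counitPre κ M) ≫ Λ ≫ unitPre adjF.unit (N.comp F) ≅
      Λ ≫ xi adjF adjH Γ :=
  -- Moving `Φ` before `Λ` makes it meet `κ_M`. The substitution for `Φ ∘ κ` then creates a second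
  -- copy of `Λ`, and the two copies exchange roles: the new one travels to the front, while the
  -- original one is absorbed by `η`.
  whiskerLeftIso _ (unitPreNat adjF.unit Λ) ≪⊗≫
    whiskerLeftIso (unitPost η M ≫ assocHom M G M)
      (whiskerRightIso
        (counitPreUnitPre κ adjF.unit M ≪≫ preWhiskerIso M eκ ≪≫
          preWhiskerComp M (preWhisker G Λ) (theta' adjF adjH Γ))
        (postWhisker Λ (L.comp F))) ≪⊗≫
    whiskerLeftIso (unitPost η M ≫ assocHom M G M ≫ preWhisker M (preWhisker G Λ))
      -- The original `Λ` passes to the other side of `Θ'`, so that `Θ'` is now whiskered by `F N`,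
      -- as in `Ξ`.
      (interchange Λ (theta' adjF adjH Γ)).symm ≪⊗≫
    whiskerLeftIso (unitPost η M)
      (whiskerRightIso (assocHomPre M G Λ)
        (postWhisker Λ (G.comp (N.comp F)) ≫ preWhisker (N.comp F) (theta' adjF adjH Γ))) ≪⊗≫
    -- The new copy of `Λ`, already past the associator, crosses `η` and becomes the leading factor.
    whiskerRightIso (unitPostNat η Λ)
      (assocHom M G (N.comp F) ≫ postWhisker Λ (G.comp (N.comp F)) ≫
        preWhisker (N.comp F) (theta' adjF adjH Γ)) ≪⊗≫
    whiskerLeftIso (Λ ≫ unitPost η (N.comp F))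
      -- The original copy, read as `(F N)(G(Λ))`, now follows `(F N)(η)`, and together they give
      -- `(F N)(Ψ'')`.
      (whiskerRightIso (assocHomPost Λ G (N.comp F))
        (preWhisker (N.comp F) (theta' adjF adjH Γ))) ≪⊗≫
    whiskerLeftIso Λ
      (whiskerRightIso
        ((unitPostComp η (postWhisker Λ G) (N.comp F)).symm ≪≫
          unitPostIso eη (N.comp F))
        (assocHom (N.comp F) G (N.comp F) ≫
          preWhisker (N.comp F) (theta' adjF adjH Γ))) ≪⊗≫
    Iso.refl (Λ ≫ (unitPost (psi'' adjH Γ) (N.comp F) ≫ assocHom (N.comp F) G (N.comp F)) ≫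
      preWhisker (N.comp F) (theta' adjF adjH Γ))

end Triangles

end BiadjTriangle

/-! ### Assembly of the biadjunction. -/

theorem mainTheorem1
    {A : Type u₁} [Bicategory.{w₁, v₁} A] {B : Type u₂} [Bicategory.{w₂, v₂} B]
    {C : Type u₃} [Bicategory.{w₃, v₃} C]
    (F : A ⥤ᵖ B) (G : B ⥤ᵖ C) (H : A ⥤ᵖ C) (Γ : F.comp G ≌ H)
    (L : B ⥤ᵖ A) (adjF : Biadjunction L F) (N : C ⥤ᵖ A) (adjH : Biadjunction N H)
    (μ : unitPre adjF.unit (N.comp F) ⟶ xi adjF adjH Γ)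
    (M : C ⥤ᵖ B) (Λ : M ⟶ N.comp F)
    (hΛ : IsInverter μ Λ)
    (hGΛ : IsInverter (postWhisker₂ μ G) (postWhisker Λ G))
    (hGμ : IsIso (psi'' adjH Γ ◁ postWhisker₂ μ G))
    (ν : unitPre adjF.unit (L.comp F) ⟶ unitPost adjF.unit (L.comp F))
    (hν : IsInverter ν adjF.unit)
    (hμν : preWhisker₂ G μ ▷ theta'' adjF adjH Γ ≫ (phi₂ adjF adjH Γ).hom =
      (phi₁ adjF adjH Γ).hom ≫ theta' adjF adjH Γ ◁ ν)
    (hGΦ : IsFullyFaithful (unitPost adjF.unit G))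
    (hΦFN : IsFullyFaithful (unitPre adjF.unit (N.comp F))) :
    Nonempty (Biadjunction M G) := by
  have hΛμ : IsIso (Λ ◁ μ) := hΛ.cone
  obtain ⟨η, ⟨eη⟩⟩ := hGΛ.exists_lift (psi'' adjH Γ) hGμ
  obtain ⟨κ, ⟨eκ⟩⟩ := hν.exists_lift _ (isIso_whiskerLeft_nu hμν hΛμ)
  obtain ⟨right⟩ := hGΦ.nonempty_iso (rightTriangleLift eη eκ)
  -- The left law is reflected in two stages: full faithfulness of `Φ_{F N}` removes `Φ_{F N}`, and
  -- the inverter `Λ` then removes `Λ`. Between them, the inverse of `μ * Λ` turns `Ξ ∘ Λ` back into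
  -- `Φ_{F N} ∘ Λ`. The explicit `𝟙 M ≫ Λ` gives `e` the shape needed for the second stage.
  obtain ⟨e⟩ := hΦFN.nonempty_iso (h := 𝟙 M ≫ Λ)
    (α_ _ _ _ ≪≫ leftTriangleLift eη eκ ≪≫ (asIso (Λ ◁ μ)).symm ≪≫
      whiskerRightIso (λ_ Λ).symm (unitPre adjF.unit (N.comp F)))
  obtain ⟨left⟩ := hΛ.nonempty_iso e
  exact ⟨⟨η, κ, left, right⟩⟩
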